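/- Let $(\mathcal X,\mathfrak S)$ be a measurable space, $P_0,P_1$ probability distributions on it, $\pi_0,\pi_1\ge 0$, and $$\tilde P_0=(1-\pi_0)P_0+\pi_0P_1,\qquad \tilde P_1=(1-\pi_1)P_1+\pi_1P_0 .$$ Let $Z_0^m=(X_0^1,\dots,X_0^m)\sim\tilde P_0^{m}$ and $Z_1^n=(X_1^1,\dots,X_1^n)\sim\tilde P_1^{n}$ be independent i.i.d. samples. For a classifier (measurable function) $f:\mathcal X\to\{0,1\}$ put $R_0(f)=P_0(f(X)=1)$, $R_1(f)=P_1(f(X)=0)$ and $$\widehat{\tilde R}_0(f)=\frac1m\sum_{i=1}^m\mathbf 1_{\{f(X_0^i)\ne0\}},\qquad \widehat{\tilde R}_1(f)=\frac1n\sum_{i=1}^n\mathbf 1_{\{f(X_1^i)\ne1\}} .$$ *Mixture proportion estimator.* Let $(\mathcal G_j)_{j\ge1}$ be sets of classifiers of finite VC dimensions $v_j$ with the universal approximation property: for every probability distribution $Q$, every classifier $f$ and every $\varepsilon>0$ there are $j$ and $g\in\mathcal G_j$ with $Q(g\neq f)<\varepsilon$. With $\varepsilon_N(j)=3\sqrt{\big(v_j\log(N+1)-\log(\delta/2)\big)/N}$,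 $\delta=1/(Nj^2)$, and with $\widehat F$, $\widehat H$ the empirical distributions of samples $Z_F$, $Z_H$ of sizes $M$, $N$, let $$\widehat\nu(Z_F,Z_H)=\inf_{j\ge 1}\ \inf_{g\in\mathcal G_j,\ \widehat H(g=1)>\varepsilon_N(j)}\ \frac{\widehat F(g=1)+\varepsilon_M(j)}{\widehat H(g=1)-\varepsilon_N(j)}$$ (the value $0$ is used if there is no admissible $g$). Put $\widehat{\tilde\pi}_0=\widehat\nu(Z_0^m,Z_1^n)$, $\widehat{\tilde\pi}_1=\widehat\nu(Z_1^n,Z_0^m)$ and $$\widehat R_0(f)=1-\widehat{\tilde R}_1(f)-\frac{1-\widehat{\tilde R}_0(f)-\widehat{\tilde R}_1(f)}{1-\widehat{\tilde\pi}_0},\qquad \widehat R_1(f)=1-\widehat{\tilde R}_0(f)-\frac{1-\widehat{\tilde R}_1(f)-\widehat{\tilde R}_0(f)}{1-\widehat{\tilde\pi}_1}$$ (a quotient with denominator $0$ is read as $0$). **Theorem.** Assume * (A) $\pi_0+\pi_1<1$; * (C) $P_0$ and $P_1$ are mutually irreducible: neither $P_0=\gamma P_1+(1-\gamma)F'$ nor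 $P_1=\gamma P_0+(1-\gamma)F'$ holds for any probability distribution $F'$ and $0<\gamma\le1$. Let $\mathcal F_1,\mathcal F_2,\dots$ be sets of classifiers, $\mathcal F_j$ having finite VC dimension $V_j$, and let $k(m,n)$ take values in $\mathbb N$ with $$\frac{V_{k(m,n)}\log(\min(m,n))}{\min(m,n)}\to0\quad\text{as }\min(m,n)\to\infty .$$ Assume the usual measurability condition for all classes $\mathcal H=\mathcal F_j$ and $\mathcal H=\mathcal G_j$: for all $N$, $e\in\mathbb R^N$ and $i=0,1$, the map $z\mapsto\sup_{f\in\mathcal H}\big|\sum_{l=1}^N e_lf(z_l)\big|$ is measurable with respect to the completion of $\tilde P_i^{N}$. Then, for $i=0,1$, $$\sup_{f\in\mathcal F_{k(m,n)}}\big|\widehat R_i(f)-R_i(f)\big|\to0\quad\text{in probability as }\min(m,n)\to\infty,$$ that is, for each $\varepsilon>0$ the (outer) $\tilde P_0^m\otimes\tilde P_1^n$-probability that the supremum exceeds $\varepsilon$ tends to $0$. -/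

import Mathlib

open MeasureTheory Filter Topology

noncomputable section

namespace LabelNoise

/-- The mixture `(1 - γ) P + γ Q`. -/
def mix {X : Type*} [MeasurableSpace X] (γ : ℝ) (P Q : Measure X) : Measure X :=
  ENNReal.ofReal (1 - γ) • P + ENNReal.ofReal γ • Q

/-- `G` is irreducible with respect to `H`: there is no decomposition
`G = γ H + (1 - γ) F'` with `0 < γ ≤ 1` and `F'` a probability distribution. -/
def IrreducibleWrt {X : Type*} [MeasurableSpace X] (G H : Measure X) : Prop :=
  ¬ ∃ (γ : ℝ) (F' : Measure X), 0 < γ ∧ γ ≤ 1 ∧ IsProbabilityMeasure F' ∧ G = mix γ F' H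

/-- `G` and `H` are mutually irreducible. -/
def MutuallyIrreducible {X : Type*} [MeasurableSpace X] (G H : Measure X) : Prop :=
  IrreducibleWrt G H ∧ IrreducibleWrt H G

/-- A set `ℱ` of `{0,1}`-valued functions shatters the finite set `T`: every subset of `T` is
cut out by a member of `ℱ`. -/
def ShattersFinset {X : Type*} (ℱ : Set (X → Fin 2)) (T : Finset X) : Prop :=
  ∀ U ⊆ T, ∃ f ∈ ℱ, ∀ x ∈ T, (f x = 1 ↔ x ∈ U)

/-- The Vapnik-Chervonenkis dimension: the supremum of the cardinalities of shattered finite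
sets (`⊤` if these are unbounded). -/
def vcDimension {X : Type*} (ℱ : Set (X → Fin 2)) : ℕ∞ :=
  ⨆ (T : Finset X) (_ : ShattersFinset ℱ T), (T.card : ℕ∞)

/-- The usual measurability condition for empirical processes indexed by `ℱ` ("`ℱ` is a
`Q`-measurable class"): for all `N` and all weights `e ∈ ℝ^N`, the map
`z ↦ sup_{f ∈ ℱ} |∑ i, e i * f (z i)|` is measurable for the completion of `Q^N`. Without such a
condition the Vapnik-Chervonenkis theorem fails (initial segments of `ω₁`). It holds in particular
for each countable class of measurable functions. -/
def IsMeasurableClass {X : Type*} [MeasurableSpace X] (ℱ : Set (X → Fin 2))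
    (Q : Measure X) : Prop :=
  ∀ (N : ℕ) (e : Fin N → ℝ),
    AEMeasurable
      (fun z : Fin N → X =>
        ⨆ f : ℱ, |∑ i, e i * (if (f : X → Fin 2) (z i) = 1 then (1 : ℝ) else 0)|)
      (Measure.pi fun _ : Fin N => Q)

/-- Type I error `P₀(f(X) = 1)`. -/
def typeI {X : Type*} [MeasurableSpace X] (P₀ : Measure X) (f : X → Fin 2) : ℝ :=
  P₀.real {x | f x = 1}

/-- Type II error `P₁(f(X) = 0)`. -/
def typeII {X : Type*} [MeasurableSpace X] (P₁ : Measure X) (f : X → Fin 2) : ℝ :=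
  P₁.real {x | f x = 0}

/-- The fraction of the sample points `z i` on which `f (z i) ≠ a`. With `a = 0` and a sample of
apparent label `0` this is the empirical contaminated Type I error, with `a = 1` and a sample of
apparent label `1` the empirical contaminated Type II error. -/
def empError {X : Type*} {N : ℕ} (a : Fin 2) (f : X → Fin 2) (z : Fin N → X) : ℝ :=
  (1 / (N : ℝ)) * ∑ i, if f (z i) ≠ a then (1 : ℝ) else 0

/-- The empirical probability of the set `{g = 1}`. -/
def empMass {X : Type*} {N : ℕ} (g : X → Fin 2) (z : Fin N → X) : ℝ :=
  (1 / (N : ℝ)) * ∑ i, if g (z i) = 1 then (1 : ℝ) else 0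

/-- The Vapnik-Chervonenkis deviation term for a class of dimension `V`, sample size `N` and
confidence parameter `δ`. -/
def vcEps (V N : ℕ) (δ : ℝ) : ℝ :=
  3 * Real.sqrt ((V * Real.log (N + 1) - Real.log (δ / 2)) / N)

/-- The deviation term for the `k`-th class of the sequence `𝒢` (numbered from `0`) and sample
size `N`: the confidence parameter is `1 / N`, divided by the square of the rank of the class. -/
def mpeEps {X : Type*} (𝒢 : ℕ → Set (X → Fin 2)) (k N : ℕ) : ℝ :=
  vcEps (vcDimension (𝒢 k)).toNat N (1 / (N * ((k : ℝ) + 1) ^ 2))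

/-- The distribution-free mixture proportion estimator of Blanchard, Lee and Scott built on the
sequence of classes `𝒢`,
`ν̂(Z_F, Z_H) = inf_k inf_{g ∈ 𝒢 k} (F̂(g = 1) + ε_m(k)) / (Ĥ(g = 1) - ε_n(k))₊`,
where a ratio with denominator `0` counts as `+∞`, so that only the `g` with
`Ĥ(g = 1) > ε_n(k)` matter. (If there is no such `g`, the value is set to `0`.) -/
def mpe {X : Type*} (𝒢 : ℕ → Set (X → Fin 2)) {m n : ℕ}
    (zF : Fin m → X) (zH : Fin n → X) : ℝ :=
  sInf {r : ℝ | ∃ k : ℕ, ∃ g ∈ 𝒢 k, 0 < empMass g zH - mpeEps 𝒢 k n ∧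
    r = (empMass g zF + mpeEps 𝒢 k m) / (empMass g zH - mpeEps 𝒢 k n)}

/-- Universal approximation: for every probability distribution, each measurable `{0,1}`-valued
function is approximated arbitrarily well by members of the classes `𝒢 k`. -/
def UniversalApprox {X : Type*} [MeasurableSpace X] (𝒢 : ℕ → Set (X → Fin 2)) : Prop :=
  ∀ Q : Measure X, IsProbabilityMeasure Q → ∀ f : X → Fin 2, Measurable f →
    ∀ ε : ℝ, 0 < ε → ∃ k : ℕ, ∃ g ∈ 𝒢 k, Q.real {x | g x ≠ f x} < ε

/-- Plug-in estimate of the Type I error; `π̃₀` is estimated by `ν̂(Z₀, Z₁)`. -/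
def estTypeI {X : Type*} (𝒢 : ℕ → Set (X → Fin 2)) {m n : ℕ} (f : X → Fin 2)
    (z₀ : Fin m → X) (z₁ : Fin n → X) : ℝ :=
  1 - empError 1 f z₁ - (1 - empError 0 f z₀ - empError 1 f z₁) / (1 - mpe 𝒢 z₀ z₁)

/-- Plug-in estimate of the Type II error; `π̃₁` is estimated by `ν̂(Z₁, Z₀)`. -/
def estTypeII {X : Type*} (𝒢 : ℕ → Set (X → Fin 2)) {m n : ℕ} (f : X → Fin 2)
    (z₀ : Fin m → X) (z₁ : Fin n → X) : ℝ :=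
  1 - empError 0 f z₀ - (1 - empError 1 f z₁ - empError 0 f z₀) / (1 - mpe 𝒢 z₁ z₀)

/-- The law `Q₀^m ⊗ Q₁^n` of two independent i.i.d. samples. -/
def sampleLaw {X : Type*} [MeasurableSpace X] (Q₀ Q₁ : Measure X) (m n : ℕ) :
    Measure ((Fin m → X) × (Fin n → X)) :=
  (Measure.pi fun _ : Fin m => Q₀).prod (Measure.pi fun _ : Fin n => Q₁)

/-- The filter on pairs `(m, n)` expressing `min(m, n) → ∞`. -/
def minAtTop : Filter (ℕ × ℕ) :=
  comap (fun p : ℕ × ℕ => min p.1 p.2) atTop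

end LabelNoise

end

open LabelNoise

namespace LabelNoise

/-! Write p = π₀ / (1 - π₁), which is < 1 by (A). Eliminating P₁ from the two mixtures gives P̃₀ =
(1 - p) P₀ + p P̃₁, so P₀ = P̃₁ - (P̃₁ - P̃₀) / (1 - p). The plug-in estimator is this formula
(`decontaminate`) with empirical masses and an estimate of p. Near p < 1 the formula is continuous,
uniformly in masses from [0, 1] (`exists_decontaminate_close`), so two facts suffice: uniform
convergence of empirical masses over the chosen class, and consistency of `mpe` for p. Type II
follows by exchanging the roles of the samples.

Uniform convergence is the Vapnik-Chervonenkis inequality `measure_uniform_deviation_le`: compare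
with a ghost sample, swap the halves at random, bound the number of traces by Sauer-Shelah and apply
Hoeffding to each trace. The growth condition on V makes the exponential win.

Consistency of `mpe` rests on p being the infimum of P̃₀(C) / P̃₁(C). The displayed identity gives
the lower bound. Irreducibility gives sets C with P₀(C) / P₁(C) arbitrarily small, hence ratios
close to p, and universal approximation replaces C by a classifier g₀ of some 𝒢 k₀. When every
empirical mass is within its deviation term, all corrected ratios are at least p, while that of g₀
is at most p + η for large samples, since its own deviation term vanishes (`exists_mpe_close`). -/

/-! ### Hoeffding's inequality for random signs -/

/-- The sign `±1` encoded by a Boolean. -/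
noncomputable def boolSign (b : Bool) : ℝ := if b then -1 else 1

/-- Hoeffding's inequality for Rademacher sums, one-sided, in counting form. -/
theorem card_signs_lt_sum_le {N : ℕ} (hN : 0 < N) (a : Fin N → ℝ) (ha : ∀ i, |a i| ≤ 1)
    {t : ℝ} (ht : 0 < t) :
    (((Finset.univ.filter fun σ : Fin N → Bool => t < ∑ i, boolSign (σ i) * a i).card : ℕ) : ℝ)
      ≤ 2 ^ N * Real.exp (-t ^ 2 / (2 * N)) := by
  have hN' : (0 : ℝ) < N := by exact_mod_cast hN
  -- The minimizer of the Chernoff exponent N l² / 2 - l t.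
  set l : ℝ := t / N with hl
  have hl0 : 0 < l := by positivity
  have hmgf : ∑ σ : Fin N → Bool, Real.exp (l * ∑ i, boolSign (σ i) * a i)
      ≤ 2 ^ N * Real.exp (N * (l ^ 2 / 2)) := by
    calc ∑ σ : Fin N → Bool, Real.exp (l * ∑ i, boolSign (σ i) * a i)
        = ∑ σ : Fin N → Bool, ∏ i, Real.exp (l * (boolSign (σ i) * a i)) := by
          simp_rw [Finset.mul_sum, Real.exp_sum]
      _ = ∏ i, ∑ b : Bool, Real.exp (l * (boolSign b * a i)) := by
          rw [Finset.prod_univ_sum, Fintype.piFinset_univ]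
      _ ≤ ∏ _i : Fin N, 2 * Real.exp (l ^ 2 / 2) := by
          refine Finset.prod_le_prod (fun i _ => by positivity) fun i _ => ?_
          have h1 : ∑ b : Bool, Real.exp (l * (boolSign b * a i)) = 2 * Real.cosh (l * a i) := by
            rw [Fintype.sum_bool, Real.cosh_eq]
            simp [boolSign]
            ring
          rw [h1]
          have h2 : (l * a i) ^ 2 ≤ l ^ 2 := by
            rw [mul_pow]
            have : (a i) ^ 2 ≤ 1 := (sq_le_one_iff_abs_le_one _).2 (ha i)
            nlinarith [sq_nonneg l]
          have := (Real.cosh_le_exp_half_sq (l * a i)).trans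
            (Real.exp_le_exp.2 (div_le_div_of_nonneg_right h2 zero_le_two))
          linarith
      _ = 2 ^ N * Real.exp (N * (l ^ 2 / 2)) := by
          rw [Finset.prod_const, mul_pow, ← Real.exp_nat_mul]; simp
  have hmarkov (S : (Fin N → Bool) → ℝ) : ((Finset.univ.filter fun σ => t < S σ).card : ℝ) *
      Real.exp (l * t) ≤ ∑ σ, Real.exp (l * S σ) := by
    rw [← nsmul_eq_mul, ← Finset.sum_const]
    refine (Finset.sum_le_sum (g := fun σ => Real.exp (l * S σ)) fun σ hσ => ?_).trans
      (Finset.sum_le_sum_of_subset_of_nonneg (Finset.subset_univ _)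
        fun _ _ _ => (Real.exp_pos _).le)
    exact Real.exp_le_exp.2 (mul_le_mul_of_nonneg_left (Finset.mem_filter.1 hσ).2.le hl0.le)
  have h := (hmarkov _).trans hmgf
  rw [← le_div_iff₀ (Real.exp_pos _), mul_div_assoc, ← Real.exp_sub] at h
  refine h.trans_eq ?_
  congr 2
  rw [hl]; field_simp; ring

/-- Hoeffding's inequality for Rademacher sums, two-sided, in counting form. -/
theorem card_signs_lt_abs_sum_le {N : ℕ} (hN : 0 < N) (a : Fin N → ℝ) (ha : ∀ i, |a i| ≤ 1)
    {t : ℝ} (ht : 0 < t) :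
    (((Finset.univ.filter fun σ : Fin N → Bool => t < |∑ i, boolSign (σ i) * a i|).card : ℕ) : ℝ)
      ≤ 2 ^ N * (2 * Real.exp (-t ^ 2 / (2 * N))) := by
  have h1 := card_signs_lt_sum_le hN a ha ht
  have h2 := card_signs_lt_sum_le hN (fun i => -a i) (fun i => by simpa using ha i) ht
  have hsub : (Finset.univ.filter fun σ : Fin N → Bool => t < |∑ i, boolSign (σ i) * a i|) ⊆
      (Finset.univ.filter fun σ : Fin N → Bool => t < ∑ i, boolSign (σ i) * a i) ∪
      (Finset.univ.filter fun σ : Fin N → Bool => t < ∑ i, boolSign (σ i) * -a i) := by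
    intro σ hσ
    simpa [lt_abs, Finset.sum_neg_distrib] using hσ
  have h3 : ((Finset.univ.filter fun σ : Fin N → Bool =>
      t < |∑ i, boolSign (σ i) * a i|).card : ℝ) ≤ _ :=
    Nat.cast_le.2 ((Finset.card_le_card hsub).trans (Finset.card_union_le _ _))
  push_cast at h3
  linarith

/-! ### Traces on a double sample and the Sauer-Shelah bound -/

/-- Each binomial is at most (2N)^k / k!, and N^k ≤ N^V; what remains is a partial sum of the series
of e². No relation between N and V is needed. -/
theorem sum_choose_two_mul_le {N : ℕ} (hN : 0 < N) (V : ℕ) :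
    ((∑ k ∈ Finset.Iic V, (2 * N).choose k : ℕ) : ℝ) ≤ Real.exp 2 * (N : ℝ) ^ V := by
  have hN1 : (1 : ℝ) ≤ N := by exact_mod_cast hN
  push_cast
  calc ∑ k ∈ Finset.Iic V, ((2 * N).choose k : ℝ)
      ≤ ∑ k ∈ Finset.Iic V, (2 : ℝ) ^ k / k.factorial * (N : ℝ) ^ V := by
        refine Finset.sum_le_sum fun k hk => ?_
        refine (Nat.choose_le_pow_div k (2 * N)).trans ?_
        push_cast
        rw [mul_pow, mul_div_right_comm]
        gcongr
        exact Finset.mem_Iic.1 hk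
    _ = (∑ k ∈ Finset.range (V + 1), (2 : ℝ) ^ k / k.factorial) * (N : ℝ) ^ V := by
        rw [Finset.sum_mul]
        congr 1
        ext; simp
    _ ≤ Real.exp 2 * (N : ℝ) ^ V := by
        gcongr
        exact Real.sum_le_exp_of_nonneg zero_le_two _

/-- The subsets of the index set cut out by `ℱ` along the points `z`. -/
noncomputable def traces {X ι : Type*} [Fintype ι] (ℱ : Set (X → Fin 2)) (z : ι → X) : Finset (Finset ι) :=
  open Classical in
  Finset.univ.filter fun A => ∃ f ∈ ℱ, ∀ i, i ∈ A ↔ f (z i) = 1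

theorem mem_traces {X ι : Type*} [Fintype ι] {ℱ : Set (X → Fin 2)} {z : ι → X} {A : Finset ι} :
    A ∈ traces ℱ z ↔ ∃ f ∈ ℱ, ∀ i, i ∈ A ↔ f (z i) = 1 := by
  simp [traces]

theorem ShattersFinset.card_le {X : Type*} {ℱ : Set (X → Fin 2)} {V : ℕ}
    (hV : vcDimension ℱ ≤ V) {T : Finset X} (hT : ShattersFinset ℱ T) : T.card ≤ V := by
  have : (T.card : ℕ∞) ≤ vcDimension ℱ := le_iSup₂_of_le T hT le_rfl
  exact_mod_cast this.trans hV

/-- Sample points may repeat, so traces are sets of indices. On a shattered index set the points are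
nevertheless distinct, since a trace meeting it in one index separates that index from the others;
hence its image is shattered in `X` and has the same size. -/
theorem vcDim_traces_le {X ι : Type*} [Fintype ι] [DecidableEq ι] {ℱ : Set (X → Fin 2)} {V : ℕ}
    (hV : vcDimension ℱ ≤ V) (z : ι → X) : (traces ℱ z).vcDim ≤ V := by
  classical
  refine Finset.sup_le fun s hs => ?_
  have hs := Finset.mem_shatterer.1 hs
  have hinj : Set.InjOn z s := by
    intro i hi j hj hij
    obtain ⟨A, hA, hAi⟩ := hs (Finset.singleton_subset_iff.2 hi)
    obtain ⟨f, -, hfA⟩ := mem_traces.1 hA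
    have h1 : i ∈ A := by
      have : i ∈ s ∩ A := by rw [hAi]; simp
      exact (Finset.mem_inter.1 this).2
    have h2 : j ∈ s ∩ A := Finset.mem_inter.2 ⟨hj, by rw [hfA, ← hij, ← hfA]; exact h1⟩
    rw [hAi] at h2
    exact (Finset.mem_singleton.1 h2).symm
  rw [← Finset.card_image_of_injOn hinj]
  refine ShattersFinset.card_le hV fun U hU => ?_
  obtain ⟨A, hA, hAU⟩ := hs (Finset.filter_subset (fun i => z i ∈ U) s)
  obtain ⟨f, hf, hfA⟩ := mem_traces.1 hA
  refine ⟨f, hf, fun x hx => ?_⟩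
  obtain ⟨i, hi, rfl⟩ := Finset.mem_image.1 hx
  rw [← hfA]
  have := congrArg (i ∈ ·) hAU
  simpa [hi] using this

/-- The Sauer-Shelah bound for double samples. -/
theorem card_traces_le {X ι : Type*} [Fintype ι] {ℱ : Set (X → Fin 2)} {V N : ℕ} (hN : 0 < N)
    (hV : vcDimension ℱ ≤ V) (hι : Fintype.card ι = 2 * N) (z : ι → X) :
    ((traces ℱ z).card : ℝ) ≤ Real.exp 2 * (N : ℝ) ^ V := by
  classical
  refine le_trans ?_ (sum_choose_two_mul_le hN V)
  rw [← hι]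
  refine Nat.cast_le.2 (((Finset.card_le_card_shatterer _).trans
    Finset.card_shatterer_le_sum_vcDim).trans ?_)
  exact Finset.sum_le_sum_of_subset (Finset.Iic_subset_Iic.2 (vcDim_traces_le hV z))

/-- The indicator of `f = 1`, as a real number. -/
noncomputable def ind {X : Type*} (f : X → Fin 2) (x : X) : ℝ := if f x = 1 then 1 else 0

theorem ind_nonneg {X : Type*} (f : X → Fin 2) (x : X) : 0 ≤ ind f x := by
  unfold ind; split_ifs <;> norm_num

theorem ind_le_one {X : Type*} (f : X → Fin 2) (x : X) : ind f x ≤ 1 := by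
  unfold ind; split_ifs <;> norm_num

/-- A union bound over the traces of `ℱ` on a double sample. -/
theorem card_signs_exists_le {X : Type*} {ℱ : Set (X → Fin 2)} {V N : ℕ} (hN : 0 < N)
    (hV : vcDimension ℱ ≤ V) (z : Fin N ⊕ Fin N → X) {t : ℝ} (ht : 0 < t) :
    open Classical in
    (((Finset.univ.filter fun σ : Fin N → Bool => ∃ f ∈ ℱ,
      t < |∑ i, boolSign (σ i) * (ind f (z (.inl i)) - ind f (z (.inr i)))|).card : ℕ) : ℝ)
      ≤ 2 ^ N * (2 * Real.exp 2 * (N : ℝ) ^ V * Real.exp (-t ^ 2 / (2 * N))) := by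
  classical
  -- The increments depend on `f` only through its trace, so the union bound runs over finitely many
  -- traces.
  set c : Finset (Fin N ⊕ Fin N) → Fin N → ℝ := fun A i =>
    (if Sum.inl i ∈ A then (1 : ℝ) else 0) - (if Sum.inr i ∈ A then (1 : ℝ) else 0) with hc
  have hsub : (Finset.univ.filter fun σ : Fin N → Bool => ∃ f ∈ ℱ,
      t < |∑ i, boolSign (σ i) * (ind f (z (.inl i)) - ind f (z (.inr i)))|) ⊆
      (traces ℱ z).biUnion fun A =>
        Finset.univ.filter fun σ : Fin N → Bool => t < |∑ i, boolSign (σ i) * c A i| := by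
    intro σ hσ
    obtain ⟨f, hf, hlt⟩ := (Finset.mem_filter.1 hσ).2
    refine Finset.mem_biUnion.2 ⟨Finset.univ.filter fun i => f (z i) = 1,
      mem_traces.2 ⟨f, hf, fun i => by simp⟩, ?_⟩
    simpa [hc, ind] using hlt
  have hc1 : ∀ A i, |c A i| ≤ 1 := by
    intro A i
    simp only [hc]
    split_ifs <;> norm_num
  have h1 : ((Finset.univ.filter fun σ : Fin N → Bool => ∃ f ∈ ℱ,
      t < |∑ i, boolSign (σ i) * (ind f (z (.inl i)) - ind f (z (.inr i)))|).card : ℝ) ≤ _ :=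
    Nat.cast_le.2 ((Finset.card_le_card hsub).trans Finset.card_biUnion_le)
  refine h1.trans ?_
  push_cast
  refine (Finset.sum_le_sum fun A _ => card_signs_lt_abs_sum_le hN (c A) (hc1 A) ht).trans ?_
  rw [Finset.sum_const, nsmul_eq_mul]
  have := card_traces_le hN hV (by simp [two_mul]) z
  calc _ ≤ Real.exp 2 * (N : ℝ) ^ V * (2 ^ N * (2 * Real.exp (-t ^ 2 / (2 * N)))) := by gcongr
    _ = _ := by ring

/-! ### Symmetrization and the Vapnik-Chervonenkis inequality -/

variable {X : Type*} [MeasurableSpace X]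

theorem measurePreserving_comp_equiv {ι κ : Type*} [Fintype ι] [Fintype κ] (Q : Measure X)
    [IsProbabilityMeasure Q] (e : κ ≃ ι) :
    MeasurePreserving (fun z : ι → X => z ∘ e) (Measure.pi fun _ => Q) (Measure.pi fun _ => Q) := by
  have h := measurePreserving_arrowCongr' (fun _ : ι => Q) (fun _ : κ => Q) e.symm
    (MeasurableEquiv.refl X) fun _ => MeasurePreserving.id _
  exact h

/-- Turns the suprema of the measurability condition into events. They are bounded by the sum of the
|w j|, so the real supremum is genuine; `0 ≤ t` covers the empty class, whose supremum is 0. -/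
theorem lt_iSup_abs_sum_iff {X ι : Type*} [Fintype ι] (ℱ : Set (X → Fin 2)) (w : ι → ℝ)
    (z : ι → X) {t : ℝ} (ht : 0 ≤ t) :
    (t < ⨆ f : ℱ, |∑ j, w j * ind (f : X → Fin 2) (z j)|) ↔
      ∃ f ∈ ℱ, t < |∑ j, w j * ind f (z j)| := by
  constructor
  · intro h
    by_contra! hcon
    exact absurd (Real.iSup_le (fun f : ℱ => hcon f f.2) ht) (not_le.2 h)
  · rintro ⟨f, hf, h⟩
    refine h.trans_le (le_ciSup (f := fun f : ℱ => |∑ j, w j * ind (f : X → Fin 2) (z j)|)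
      ⟨∑ j, |w j|, ?_⟩ ⟨f, hf⟩)
    rintro _ ⟨g, rfl⟩
    refine (Finset.abs_sum_le_sum_abs _ _).trans (Finset.sum_le_sum fun j _ => ?_)
    rw [abs_mul, abs_of_nonneg (ind_nonneg _ _)]
    exact mul_le_of_le_one_right (abs_nonneg _) (ind_le_one _ _)

theorem IsMeasurableClass.nullMeasurableSet {ι : Type*} [Fintype ι] {ℱ : Set (X → Fin 2)}
    {Q : Measure X} [IsProbabilityMeasure Q] (h : IsMeasurableClass ℱ Q) (w : ι → ℝ)
    {t : ℝ} (ht : 0 ≤ t) :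
    NullMeasurableSet {z : ι → X | ∃ f ∈ ℱ, t < |∑ j, w j * ind f (z j)|}
      (Measure.pi fun _ => Q) := by
  set e : Fin (Fintype.card ι) ≃ ι := (Fintype.equivFin ι).symm
  have h1 := (h _ (w ∘ e)).comp_quasiMeasurePreserving
    (measurePreserving_comp_equiv Q e).quasiMeasurePreserving
  have h2 := nullMeasurableSet_lt (aemeasurable_const (b := t)) h1
  convert h2 using 3 with z
  rw [← lt_iSup_abs_sum_iff ℱ w z ht]
  simp only [Function.comp_apply]
  have : ∀ f : X → Fin 2, ∑ i, w (e i) * (if f (z (e i)) = 1 then (1 : ℝ) else 0) =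
      ∑ j, w j * ind f (z j) := fun f => e.sum_comp fun j => w j * ind f (z j)
  simp only [this]

/-- Exchange the two halves of a double sample at the places marked by `σ`. -/
def swapAt {N : ℕ} (σ : Fin N → Bool) : Equiv.Perm (Fin N ⊕ Fin N) :=
  Function.Involutive.toPerm
    (Sum.elim (fun i => if σ i then .inr i else .inl i) (fun i => if σ i then .inl i else .inr i))
    (by
      rintro (i | i) <;> by_cases h : σ i <;> simp [h])

theorem swapAt_inl {N : ℕ} (σ : Fin N → Bool) (i : Fin N) :
    swapAt σ (.inl i) = if σ i then .inr i else .inl i := rfl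

theorem swapAt_inr {N : ℕ} (σ : Fin N → Bool) (i : Fin N) :
    swapAt σ (.inr i) = if σ i then .inl i else .inr i := rfl

/-- The tail of the supremum of the symmetrized empirical process. -/
theorem measure_double_sample_le {ℱ : Set (X → Fin 2)} {V N : ℕ} (hN : 0 < N)
    (hV : vcDimension ℱ ≤ V) {Q : Measure X} [IsProbabilityMeasure Q]
    (hmeas : IsMeasurableClass ℱ Q) {t : ℝ} (ht : 0 < t) :
    (Measure.pi fun _ : Fin N ⊕ Fin N => Q)
      {z | ∃ f ∈ ℱ, t < |∑ i, (ind f (z (.inl i)) - ind f (z (.inr i)))|}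
      ≤ ENNReal.ofReal (2 * Real.exp 2 * (N : ℝ) ^ V * Real.exp (-t ^ 2 / (2 * N))) := by
  classical
  set μ := Measure.pi fun _ : Fin N ⊕ Fin N => Q
  set B : (Fin N → Bool) → Set (Fin N ⊕ Fin N → X) := fun σ =>
    {z | ∃ f ∈ ℱ, t < |∑ i, boolSign (σ i) * (ind f (z (.inl i)) - ind f (z (.inr i)))|} with hB
  have hBnull : ∀ σ, NullMeasurableSet (B σ) μ := by
    intro σ
    convert hmeas.nullMeasurableSet
      (Sum.elim (fun i => boolSign (σ i)) (fun i => -boolSign (σ i))) ht.le using 4 with z f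
    simp only [Fintype.sum_sum_type, Sum.elim_inl, Sum.elim_inr, ← Finset.sum_add_distrib]
    ring_nf
  -- Swapping the i-th pair flips the sign of the i-th increment and preserves the product law.
  have hBmeas : ∀ σ, μ (B σ) = μ (B fun _ => false) := by
    intro σ
    rw [← (measurePreserving_comp_equiv Q (swapAt σ)).measure_preimage (hBnull fun _ => false)]
    congr 1
    ext z
    simp only [hB, Set.mem_preimage, Set.mem_ofPred_eq]
    refine exists_congr fun f => and_congr_right fun _ => ?_
    have : ∀ i, boolSign (σ i) * (ind f (z (.inl i)) - ind f (z (.inr i))) =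
        boolSign false * (ind f ((z ∘ swapAt σ) (.inl i)) - ind f ((z ∘ swapAt σ) (.inr i))) := by
      intro i
      by_cases h : σ i <;> simp [h, swapAt_inl, swapAt_inr, boolSign]
    simp only [this]
  set c : ℝ := 2 * Real.exp 2 * (N : ℝ) ^ V * Real.exp (-t ^ 2 / (2 * N)) with hc
  -- The average over all sign patterns is taken inside the integral, where for each fixed `z` the
  -- counting bound applies.
  have hsum : (2 : ENNReal) ^ N * μ (B fun _ => false) ≤ 2 ^ N * ENNReal.ofReal c := by
    calc (2 : ENNReal) ^ N * μ (B fun _ => false)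
        = ∑ σ : Fin N → Bool, μ (B σ) := by
          simp [hBmeas]
      _ = ∑ σ : Fin N → Bool, ∫⁻ z, (B σ).indicator 1 z ∂μ := by
          simp_rw [lintegral_indicator_one₀ (hBnull _)]
      _ = ∫⁻ z, ∑ σ : Fin N → Bool, (B σ).indicator 1 z ∂μ := by
          rw [lintegral_finsetSum']
          exact fun σ _ => aemeasurable_const.indicator₀ (hBnull σ)
      _ ≤ ∫⁻ _, ENNReal.ofReal (2 ^ N * c) ∂μ := by
          refine lintegral_mono fun z => ?_
          have h1 : ∑ σ : Fin N → Bool, (B σ).indicator (1 : (Fin N ⊕ Fin N → X) → ENNReal) z =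
              ((Finset.univ.filter fun σ : Fin N → Bool => z ∈ B σ).card : ENNReal) := by
            simp [Set.indicator_apply, Finset.sum_boole]
          rw [h1, ← ENNReal.ofReal_natCast]
          refine ENNReal.ofReal_le_ofReal ?_
          convert card_signs_exists_le hN hV z ht using 3
          ext σ
          simp [hB]
      _ = 2 ^ N * ENNReal.ofReal c := by
          rw [lintegral_const, measure_univ, mul_one, ENNReal.ofReal_mul (by positivity),
            ENNReal.ofReal_pow zero_le_two, ENNReal.ofReal_ofNat]
  have h := (ENNReal.mul_le_mul_iff_right (by simp) (by finiteness)).1 hsum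
  refine le_trans (le_of_eq ?_) h
  congr 1
  simp [hB, boolSign]

theorem empMass_eq {X : Type*} {N : ℕ} (g : X → Fin 2) (z : Fin N → X) :
    empMass g z = (1 / (N : ℝ)) * ∑ i, ind g (z i) := rfl

theorem measurable_ind {f : X → Fin 2} (hf : Measurable f) : Measurable (ind f) :=
  Measurable.ite (hf (measurableSet_singleton 1)) measurable_const measurable_const

theorem integral_ind {f : X → Fin 2} (hf : Measurable f) (Q : Measure X) :
    ∫ x, ind f x ∂Q = Q.real {x | f x = 1} := by
  have : ind f = Set.indicator {x | f x = 1} 1 := by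
    ext x; simp [ind, Set.indicator_apply]
  rw [this]
  exact integral_indicator_one (hf (measurableSet_singleton 1))

/-- Chebyshev's inequality for an empirical frequency. -/
theorem measure_empMass_deviation_le {f : X → Fin 2} (hf : Measurable f) (Q : Measure X)
    [IsProbabilityMeasure Q] {N : ℕ} (hN : 0 < N) {ε : ℝ} (hε : 0 < ε) :
    (Measure.pi fun _ : Fin N => Q) {z | ε ≤ |empMass f z - Q.real {x | f x = 1}|}
      ≤ ENNReal.ofReal (1 / (4 * N * ε ^ 2)) := by
  have hN' : (0 : ℝ) < N := by exact_mod_cast hN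
  have hbdd : ∀ᵐ x ∂Q, ind f x ∈ Set.Icc (0 : ℝ) 1 :=
    Eventually.of_forall fun x => ⟨ind_nonneg f x, ind_le_one f x⟩
  have hL : MemLp (ind f) 2 Q := memLp_of_bounded hbdd (measurable_ind hf).aestronglyMeasurable 2
  set S : (Fin N → X) → ℝ := ∑ i, fun z => ind f (z i) with hS
  have hLi : ∀ i : Fin N, MemLp (fun z : Fin N → X => ind f (z i)) 2 (Measure.pi fun _ => Q) :=
    fun i => hL.comp_measurePreserving (measurePreserving_eval (fun _ : Fin N => Q) i)
  have hLS : MemLp S 2 (Measure.pi fun _ => Q) := memLp_finsetSum' _ fun i _ => hLi i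
  have hvar : ProbabilityTheory.variance S (Measure.pi fun _ => Q) ≤ N * (1 / 4) := by
    rw [hS, ProbabilityTheory.variance_sum_pi (μ := fun _ : Fin N => Q)
      (X := fun _ => ind f) fun _ => hL]
    have := ProbabilityTheory.variance_le_sq_of_bounded hbdd (measurable_ind hf).aemeasurable
    simp only [Finset.sum_const, Finset.card_univ, Fintype.card_fin, nsmul_eq_mul]
    norm_num at this ⊢
    exact mul_le_mul_of_nonneg_left this hN'.le
  have hmean : ∫ z, S z ∂(Measure.pi fun _ => Q) = N * Q.real {x | f x = 1} := by
    simp only [hS, Finset.sum_apply]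
    rw [integral_finsetSum _ fun i _ => (hLi i).integrable one_le_two]
    have : ∀ i : Fin N, ∫ z : Fin N → X, ind f (z i) ∂(Measure.pi fun _ => Q) =
        Q.real {x | f x = 1} := by
      intro i
      rw [← integral_ind hf]
      exact integral_comp_eval (μ := fun _ : Fin N => Q) (measurable_ind hf).aestronglyMeasurable
    simp [this]
  have h := ProbabilityTheory.meas_ge_le_variance_div_sq hLS (c := N * ε) (by positivity)
  rw [hmean] at h
  refine (measure_mono fun z hz => ?_).trans (h.trans (ENNReal.ofReal_le_ofReal ?_))
  · simp only [Set.mem_ofPred_eq] at hz ⊢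
    have : S z - N * Q.real {x | f x = 1} = N * (empMass f z - Q.real {x | f x = 1}) := by
      rw [empMass_eq, hS, Finset.sum_apply]; field_simp
    rw [this, abs_mul, abs_of_pos hN']
    gcongr
  · rw [div_le_div_iff₀ (by positivity) (by positivity)]
    calc _ ≤ N * (1 / 4) * (4 * N * ε ^ 2) := by gcongr
      _ = _ := by ring

/-- Symmetrization by a ghost sample. -/
theorem measure_deviation_le_two_mul {ℱ : Set (X → Fin 2)} (hℱ : ∀ f ∈ ℱ, Measurable f)
    (Q : Measure X) [IsProbabilityMeasure Q] {N : ℕ} (hN : 0 < N) {ε : ℝ} (hε : 0 < ε)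
    (hNε : 2 ≤ N * ε ^ 2) :
    (Measure.pi fun _ : Fin N => Q) {z | ∃ f ∈ ℱ, ε < |empMass f z - Q.real {x | f x = 1}|}
      ≤ 2 * (Measure.pi fun _ : Fin N ⊕ Fin N => Q)
        {z | ∃ f ∈ ℱ, N * ε / 2 < |∑ i, (ind f (z (.inl i)) - ind f (z (.inr i)))|} := by
  have hN' : (0 : ℝ) < N := by exact_mod_cast hN
  set μ := Measure.pi fun _ : Fin N => Q
  set B := {z : Fin N ⊕ Fin N → X |
    ∃ f ∈ ℱ, N * ε / 2 < |∑ i, (ind f (z (.inl i)) - ind f (z (.inr i)))|} with hB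
  have hmp := measurePreserving_sumPiEquivProdPi_symm (fun _ : Fin N ⊕ Fin N => Q)
  set T := (MeasurableEquiv.sumPiEquivProdPi fun _ : Fin N ⊕ Fin N => X).symm
  -- `B` need not be measurable; its measurable hull has the same measure and admits Fubini.
  set B' := T ⁻¹' (toMeasurable (Measure.pi fun _ : Fin N ⊕ Fin N => Q) B) with hB'
  have hB'm : MeasurableSet B' := T.measurable (measurableSet_toMeasurable _ _)
  have hB'μ : (μ.prod μ) B' = (Measure.pi fun _ : Fin N ⊕ Fin N => Q) B := by
    rw [hB', hmp.measure_preimage (measurableSet_toMeasurable _ _).nullMeasurableSet,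
      measure_toMeasurable]
  rw [← hB'μ, Measure.prod_apply hB'm]
  have hsub : {z : Fin N → X | ∃ f ∈ ℱ, ε < |empMass f z - Q.real {x | f x = 1}|} ⊆
      {x | (2 : ENNReal)⁻¹ ≤ μ (Prod.mk x ⁻¹' B')} := by
    rintro x ⟨f, hf, hx⟩
    simp only [Set.mem_ofPred_eq]
    -- Chebyshev at ε / 2 gives 1 / (N ε²), at most 1/2 by `hNε`. So the ghost sample is within ε /
    -- 2 of the truth with probability at least 1/2, which accounts for the factor 2.
    have hcheb : μ {z | ε / 2 ≤ |empMass f z - Q.real {x | f x = 1}|} ≤ 2⁻¹ := by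
      refine (measure_empMass_deviation_le (hℱ f hf) Q hN (half_pos hε)).trans ?_
      rw [← ENNReal.ofReal_ofNat, ← ENNReal.ofReal_inv_of_pos two_pos]
      refine ENNReal.ofReal_le_ofReal ?_
      rw [one_div]
      exact inv_anti₀ two_pos (by nlinarith)
    have hmeas : MeasurableSet {z : Fin N → X | ε / 2 ≤ |empMass f z - Q.real {x | f x = 1}|} := by
      have := measurable_ind (hℱ f hf)
      simp only [empMass_eq]
      exact measurableSet_le measurable_const (by fun_prop)
    have hcompl : 2⁻¹ ≤ μ {z | ε / 2 ≤ |empMass f z - Q.real {x | f x = 1}|}ᶜ := by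
      rw [prob_compl_eq_one_sub hmeas]
      refine le_trans ?_ (tsub_le_tsub_left hcheb 1)
      rw [ENNReal.one_sub_inv_two]
    refine hcompl.trans (measure_mono fun y hy => ?_)
    refine subset_toMeasurable _ _ ⟨f, hf, ?_⟩
    have hy' : |empMass f y - Q.real {x | f x = 1}| < ε / 2 := not_le.1 hy
    have hsum : ∑ i, (ind f (T (x, y) (.inl i)) - ind f (T (x, y) (.inr i))) =
        N * (empMass f x - empMass f y) := by
      rw [empMass_eq, empMass_eq, Finset.sum_sub_distrib]
      field_simp
      rfl
    rw [hsum, abs_mul, abs_of_pos hN', mul_div_assoc]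
    refine mul_lt_mul_of_pos_left ?_ hN'
    have := abs_sub_le (empMass f x) (empMass f y) (Q.real {x | f x = 1})
    linarith
  have hmark := mul_meas_ge_le_lintegral₀ (μ := μ)
    (measurable_measure_prodMk_left (ν := μ) hB'm).aemeasurable 2⁻¹
  calc μ {z | ∃ f ∈ ℱ, ε < |empMass f z - Q.real {x | f x = 1}|}
      ≤ 2 * (2⁻¹ * μ {x | (2 : ENNReal)⁻¹ ≤ μ (Prod.mk x ⁻¹' B')}) := by
        rw [← mul_assoc, ENNReal.mul_inv_cancel two_ne_zero ENNReal.ofNat_ne_top, one_mul]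
        exact measure_mono hsub
    _ ≤ _ := by gcongr

/-- The Vapnik-Chervonenkis inequality. -/
theorem measure_uniform_deviation_le {ℱ : Set (X → Fin 2)} (hℱ : ∀ f ∈ ℱ, Measurable f)
    {V N : ℕ} (hV : vcDimension ℱ ≤ V) {Q : Measure X} [IsProbabilityMeasure Q]
    (hmeas : IsMeasurableClass ℱ Q) (hN : 0 < N) {ε : ℝ} (hε : 0 < ε) (hNε : 2 ≤ N * ε ^ 2) :
    (Measure.pi fun _ : Fin N => Q) {z | ∃ f ∈ ℱ, ε < |empMass f z - Q.real {x | f x = 1}|}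
      ≤ ENNReal.ofReal (4 * Real.exp 2 * (N : ℝ) ^ V * Real.exp (-(N * ε ^ 2) / 8)) := by
  have hN' : (0 : ℝ) < N := by exact_mod_cast hN
  refine (measure_deviation_le_two_mul hℱ Q hN hε hNε).trans ?_
  refine (mul_le_mul_right (measure_double_sample_le hN hV hmeas (by positivity)) 2).trans_eq ?_
  rw [← ENNReal.ofReal_ofNat 2, ← ENNReal.ofReal_mul zero_le_two]
  congr 1
  rw [show -(N * ε / 2) ^ 2 / (2 * N) = -(N * ε ^ 2) / 8 by field_simp; ring]
  ring

/-! ### Mixtures, irreducibility and the proportion as an infimum of ratios -/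

theorem isProbabilityMeasure_mix {γ : ℝ} (h0 : 0 ≤ γ) (h1 : γ ≤ 1) (P Q : Measure X)
    [IsProbabilityMeasure P] [IsProbabilityMeasure Q] : IsProbabilityMeasure (mix γ P Q) := by
  constructor
  simp only [mix, Measure.add_apply, Measure.smul_apply, measure_univ, smul_eq_mul, mul_one]
  rw [← ENNReal.ofReal_add (by linarith) h0]
  simp

theorem mix_real_apply {γ : ℝ} (h0 : 0 ≤ γ) (h1 : γ ≤ 1) (P Q : Measure X)
    [IsProbabilityMeasure P] [IsProbabilityMeasure Q] (s : Set X) :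
    (mix γ P Q).real s = (1 - γ) * P.real s + γ * Q.real s := by
  simp only [mix, Measure.real, Measure.add_apply, Measure.smul_apply, smul_eq_mul]
  rw [ENNReal.toReal_add (by finiteness) (by finiteness), ENNReal.toReal_mul, ENNReal.toReal_mul,
    ENNReal.toReal_ofReal h0, ENNReal.toReal_ofReal (by linarith)]

/-- Otherwise G ≥ γ H for a small γ > 0, and (G - γ H) / (1 - γ) is a probability measure exhibiting
the forbidden decomposition. Capping γ at 1/2 keeps 1 - γ invertible. -/
theorem IrreducibleWrt.exists_real_lt {G H : Measure X} [IsProbabilityMeasure G]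
    [IsProbabilityMeasure H] (h : IrreducibleWrt G H) {η : ℝ} (hη : 0 < η) :
    ∃ C, MeasurableSet C ∧ G.real C < η * H.real C := by
  by_contra! hcon
  set γ := min η (1 / 2) with hγ
  have hγ0 : 0 < γ := lt_min hη (by norm_num)
  have hγ1 : γ ≤ 1 / 2 := min_le_right _ _
  have hle : ENNReal.ofReal γ • H ≤ G := by
    refine Measure.le_intro fun C hC _ => ?_
    rw [Measure.smul_apply, smul_eq_mul, ← ofReal_measureReal (μ := H),
      ← ofReal_measureReal (μ := G), ← ENNReal.ofReal_mul hγ0.le]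
    refine ENNReal.ofReal_le_ofReal (le_trans ?_ (hcon C hC))
    exact mul_le_mul_of_nonneg_right (min_le_left _ _) measureReal_nonneg
  have hne : ENNReal.ofReal (1 - γ) ≠ 0 := by
    rw [Ne, ENNReal.ofReal_eq_zero]; linarith
  have : IsFiniteMeasure (ENNReal.ofReal γ • H) := Measure.smul_finite _ ENNReal.ofReal_ne_top
  refine h ⟨γ, (ENNReal.ofReal (1 - γ))⁻¹ • (G - ENNReal.ofReal γ • H), hγ0, by linarith, ⟨?_⟩, ?_⟩
  · rw [Measure.smul_apply, Measure.sub_apply .univ hle, Measure.smul_apply, measure_univ,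
      measure_univ, smul_eq_mul, smul_eq_mul, mul_one, ← ENNReal.ofReal_one,
      ← ENNReal.ofReal_sub _ hγ0.le]
    rw [ENNReal.ofReal_one]
    exact ENNReal.inv_mul_cancel hne ENNReal.ofReal_ne_top
  · rw [mix, smul_smul, ENNReal.mul_inv_cancel hne ENNReal.ofReal_ne_top, one_smul,
      Measure.sub_add_cancel_of_le hle]

/-- The true proportion `π₀ / (1 - π₁)` is a lower bound for the ratios `P̃₀(C) / P̃₁(C)`. -/
theorem proportion_mul_le {π₀ π₁ : ℝ} (hπ₀ : 0 ≤ π₀) (hπ₁ : 0 ≤ π₁) (hA : π₀ + π₁ < 1)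
    (P₀ P₁ : Measure X) [IsProbabilityMeasure P₀] [IsProbabilityMeasure P₁] (C : Set X) :
    π₀ / (1 - π₁) * (mix π₁ P₁ P₀).real C ≤ (mix π₀ P₀ P₁).real C := by
  rw [mix_real_apply hπ₀ (by linarith), mix_real_apply hπ₁ (by linarith), div_mul_eq_mul_div,
    div_le_iff₀ (by linarith)]
  -- After clearing the denominator, the two sides differ by (1 - π₀ - π₁) P₀(C).
  have := measureReal_nonneg (μ := P₀) (s := C)
  nlinarith [mul_nonneg this (sub_nonneg.2 hA.le)]

/-- A set where P₀ is small relative to P₁ has ratio below p + η. The inequality is strict, so it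
survives replacing the set by a close enough approximating classifier. -/
theorem exists_classifier_ratio_lt {π₀ π₁ : ℝ} (hπ₀ : 0 ≤ π₀) (hπ₁ : 0 ≤ π₁) (hA : π₀ + π₁ < 1)
    (P₀ P₁ : Measure X) [IsProbabilityMeasure P₀] [IsProbabilityMeasure P₁]
    (hC : IrreducibleWrt P₀ P₁) {𝒢 : ℕ → Set (X → Fin 2)} (happ : UniversalApprox 𝒢)
    {η : ℝ} (hη : 0 < η) :
    ∃ k, ∃ g ∈ 𝒢 k, (mix π₀ P₀ P₁).real {x | g x = 1} <
      (π₀ / (1 - π₁) + η) * (mix π₁ P₁ P₀).real {x | g x = 1} := by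
  classical
  set F := mix π₀ P₀ P₁ with hF
  set H := mix π₁ P₁ P₀ with hH
  have : IsProbabilityMeasure F := isProbabilityMeasure_mix hπ₀ (by linarith) _ _
  have : IsProbabilityMeasure H := isProbabilityMeasure_mix hπ₁ (by linarith) _ _
  have hq : 0 < 1 - π₁ := by linarith
  set p := π₀ / (1 - π₁) with hp
  have hp0 : 0 ≤ p := by positivity
  -- The tolerance η (1 - π₁) yields P₀(C) < η (1 - π₁) P₁(C) ≤ η H(C).
  obtain ⟨C, hCm, hCl⟩ := hC.exists_real_lt (mul_pos hη hq)
  have hlt : F.real C < (p + η) * H.real C := by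
    have h1 : F.real C ≤ p * H.real C + P₀.real C := by
      rw [hF, hH, mix_real_apply hπ₀ (by linarith), mix_real_apply hπ₁ (by linarith)]
      have h2 : p * (1 - π₁) = π₀ := by rw [hp]; field_simp
      have h3 := measureReal_nonneg (μ := P₀) (s := C)
      have h4 := mul_nonneg (mul_nonneg hp0 hπ₁) h3
      have h5 := mul_nonneg hπ₀ h3
      calc (1 - π₀) * P₀.real C + π₀ * P₁.real C
          ≤ π₀ * P₁.real C + p * π₁ * P₀.real C + P₀.real C := by linarith
        _ = _ := by rw [← h2]; ring
    have h2 : (1 - π₁) * P₁.real C ≤ H.real C := by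
      rw [hH, mix_real_apply hπ₁ (by linarith)]
      have := mul_nonneg hπ₁ (measureReal_nonneg (μ := P₀) (s := C))
      linarith
    nlinarith
  set d := (p + η) * H.real C - F.real C with hd
  have hd0 : 0 < d := by linarith
  set f : X → Fin 2 := fun x => if x ∈ C then 1 else 0 with hf
  have hfm : Measurable f := Measurable.ite hCm measurable_const measurable_const
  have hfC : ∀ x, f x = 1 ↔ x ∈ C := fun x => by by_cases h : x ∈ C <;> simp [hf, h]
  -- Approximating under (F + H) / 2 controls both measures at once: the disagreement set D has F(D)
  -- + H(D) < d / (1 + p + η), so F(D) + (p + η) H(D) stays below the gap `d`.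
  obtain ⟨k, g, hg, hgf⟩ := happ (mix (1 / 2) F H)
    (isProbabilityMeasure_mix (by norm_num) (by norm_num) _ _) f hfm
    (d / (2 * (1 + p + η))) (by positivity)
  refine ⟨k, g, hg, ?_⟩
  rw [mix_real_apply (by norm_num) (by norm_num), lt_div_iff₀ (by positivity)] at hgf
  have h1 : F.real {x | g x = 1} ≤ F.real C + F.real {x | g x ≠ f x} := by
    refine (measureReal_mono fun x hx => ?_).trans (measureReal_union_le _ _)
    by_cases h : x ∈ C
    · exact .inl h
    · refine .inr fun he => h ((hfC x).1 (he ▸ hx))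
  have h2 : H.real C ≤ H.real {x | g x = 1} + H.real {x | g x ≠ f x} := by
    refine (measureReal_mono fun x hx => ?_).trans (measureReal_union_le _ _)
    by_cases h : g x = 1
    · exact .inl h
    · exact .inr fun he => h (he.trans ((hfC x).2 hx))
  have h3 := measureReal_nonneg (μ := F) (s := {x | g x ≠ f x})
  have h4 := measureReal_nonneg (μ := H) (s := {x | g x ≠ f x})
  nlinarith [mul_nonneg h3 (add_nonneg hp0 hη.le)]

/-! ### Deviation terms of the proportion estimator -/

theorem mpeEps_nonneg {X : Type*} (𝒢 : ℕ → Set (X → Fin 2)) (k N : ℕ) : 0 ≤ mpeEps 𝒢 k N := by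
  unfold mpeEps vcEps; positivity

theorem neg_log_confidence {N : ℕ} (hN : 0 < N) (k : ℕ) :
    -Real.log (1 / (N * ((k : ℝ) + 1) ^ 2) / 2) = Real.log (2 * N * ((k : ℝ) + 1) ^ 2) := by
  rw [← Real.log_inv]
  congr 1
  have : (N : ℝ) ≠ 0 := by positivity
  field_simp

theorem tendsto_mpeEps {X : Type*} (𝒢 : ℕ → Set (X → Fin 2)) (k : ℕ) :
    Tendsto (fun N => mpeEps 𝒢 k N) atTop (𝓝 0) := by
  set v := (vcDimension (𝒢 k)).toNat with hv
  have hlog : Tendsto (fun N : ℕ => Real.log N / N) atTop (𝓝 0) :=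
    Real.isLittleO_log_id_atTop.tendsto_div_nhds_zero.comp tendsto_natCast_atTop_atTop
  have hinv : Tendsto (fun N : ℕ => 1 / (N : ℝ)) atTop (𝓝 0) :=
    tendsto_one_div_atTop_nhds_zero_nat
  set c := Real.log (2 * ((k : ℝ) + 1) ^ 2) with hc
  have hup : Tendsto (fun N : ℕ => 3 * Real.sqrt
      (v * (Real.log N / N + Real.log 2 * (1 / N)) + (Real.log N / N + c * (1 / N))))
      atTop (𝓝 0) := by
    have h := ((((hlog.add (hinv.const_mul (Real.log 2))).const_mul (v : ℝ)).add
      (hlog.add (hinv.const_mul c))).sqrt).const_mul 3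
    simpa using h
  refine tendsto_of_tendsto_of_tendsto_of_le_of_le' tendsto_const_nhds hup
    (Eventually.of_forall fun N => mpeEps_nonneg 𝒢 k N) ?_
  filter_upwards [eventually_gt_atTop 0] with N hN
  have hN' : (0 : ℝ) < N := by exact_mod_cast hN
  have hN1 : (1 : ℝ) ≤ N := by exact_mod_cast hN
  unfold mpeEps vcEps
  rw [sub_eq_add_neg, neg_log_confidence hN]
  have h1 : Real.log (N + 1) ≤ Real.log N + Real.log 2 := by
    rw [← Real.log_mul (by positivity) (by norm_num)]
    exact Real.log_le_log (by positivity) (by linarith)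
  have h2 : Real.log (2 * N * ((k : ℝ) + 1) ^ 2) = Real.log N + c := by
    rw [hc, ← Real.log_mul (by positivity) (by positivity)]
    congr 1; ring
  rw [h2, ← hv]
  gcongr
  calc (v * Real.log (N + 1) + (Real.log N + c)) / N
      ≤ (v * (Real.log N + Real.log 2) + (Real.log N + c)) / N := by gcongr
    _ = _ := by ring

/-- The factor 3 gives N ε² = 9 L, so the exponent in the Vapnik-Chervonenkis inequality is -9L/8 ≤
-L. Then exp(-L) cancels N^v and leaves a bound of order 1 / N that is summable over the classes. -/
theorem measure_mpeEps_lt_le {𝒢 : ℕ → Set (X → Fin 2)} (h𝒢 : ∀ j, ∀ g ∈ 𝒢 j, Measurable g)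
    (hvc : ∀ j, vcDimension (𝒢 j) ≠ ⊤) {Q : Measure X} [IsProbabilityMeasure Q]
    (hmeas : ∀ j, IsMeasurableClass (𝒢 j) Q) {N : ℕ} (hN : 0 < N) (k : ℕ) :
    (Measure.pi fun _ : Fin N => Q)
      {z | ∃ g ∈ 𝒢 k, mpeEps 𝒢 k N < |empMass g z - Q.real {x | g x = 1}|}
      ≤ ENNReal.ofReal (2 * Real.exp 2 * (1 / N) * (1 / ((k : ℝ) + 1) ^ 2)) := by
  have hN' : (0 : ℝ) < N := by exact_mod_cast hN
  have hN1 : (1 : ℝ) ≤ N := by exact_mod_cast hN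
  set v := (vcDimension (𝒢 k)).toNat with hv
  have hV : vcDimension (𝒢 k) ≤ v := (ENat.natCast_toNat (hvc k)).ge
  set L := v * Real.log (N + 1) + Real.log (2 * N * ((k : ℝ) + 1) ^ 2) with hL
  -- A lower bound just under log 2; it ensures 9 L ≥ 2, as symmetrization requires.
  have hlog2 : 0.69 < Real.log (2 * N * ((k : ℝ) + 1) ^ 2) := by
    have h1 : Real.log 2 ≤ Real.log (2 * N * ((k : ℝ) + 1) ^ 2) := by
      refine Real.log_le_log two_pos ?_
      have h2 : (1 : ℝ) ≤ ((k : ℝ) + 1) ^ 2 := one_le_pow₀ (by linarith [k.cast_nonneg (α := ℝ)])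
      nlinarith
    linarith [Real.log_two_gt_d9]
  have hL0 : 0.69 < L := by
    have : 0 ≤ v * Real.log (N + 1) := mul_nonneg v.cast_nonneg (Real.log_nonneg (by linarith))
    linarith
  have hε : mpeEps 𝒢 k N = 3 * Real.sqrt (L / N) := by
    unfold mpeEps vcEps
    rw [sub_eq_add_neg, neg_log_confidence hN]
  have hε2 : N * mpeEps 𝒢 k N ^ 2 = 9 * L := by
    rw [hε, mul_pow, Real.sq_sqrt (by positivity)]
    field_simp; norm_num
  have hεpos : 0 < mpeEps 𝒢 k N := by rw [hε]; positivity
  refine (measure_uniform_deviation_le (h𝒢 k) hV (hmeas k) hN hεpos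
    (by rw [hε2]; linarith)).trans (ENNReal.ofReal_le_ofReal ?_)
  rw [hε2]
  have hexp : Real.exp (-(9 * L) / 8) ≤ ((N : ℝ) ^ v * (2 * N * ((k : ℝ) + 1) ^ 2))⁻¹ := by
    calc Real.exp (-(9 * L) / 8) ≤ Real.exp (-L) := Real.exp_le_exp.2 (by linarith)
      _ = (((N : ℝ) + 1) ^ v * (2 * N * ((k : ℝ) + 1) ^ 2))⁻¹ := by
        rw [Real.exp_neg, hL, Real.exp_add, Real.exp_nat_mul, Real.exp_log (by positivity),
          Real.exp_log (by positivity)]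
      _ ≤ _ := by gcongr; linarith
  calc 4 * Real.exp 2 * (N : ℝ) ^ v * Real.exp (-(9 * L) / 8)
      ≤ 4 * Real.exp 2 * (N : ℝ) ^ v * ((N : ℝ) ^ v * (2 * N * ((k : ℝ) + 1) ^ 2))⁻¹ := by gcongr
    _ = _ := by field_simp; norm_num

/-- With probability tending to one, all empirical frequencies over all classes `𝒢 k` are within
the deviation terms of the estimator. -/
theorem tendsto_measure_mpeEps_lt {𝒢 : ℕ → Set (X → Fin 2)} (h𝒢 : ∀ j, ∀ g ∈ 𝒢 j, Measurable g)
    (hvc : ∀ j, vcDimension (𝒢 j) ≠ ⊤) {Q : Measure X} [IsProbabilityMeasure Q]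
    (hmeas : ∀ j, IsMeasurableClass (𝒢 j) Q) :
    Tendsto (fun N : ℕ => (Measure.pi fun _ : Fin N => Q)
      {z | ∃ k, ∃ g ∈ 𝒢 k, mpeEps 𝒢 k N < |empMass g z - Q.real {x | g x = 1}|}) atTop (𝓝 0) := by
  have hs : Summable fun k : ℕ => 1 / ((k : ℝ) + 1) ^ 2 := by
    have := (summable_nat_add_iff 1).2 (Real.summable_one_div_nat_pow.2 one_lt_two)
    simpa using this
  have hup : Tendsto (fun N : ℕ => ENNReal.ofReal
      (2 * Real.exp 2 * (1 / N) * ∑' k : ℕ, 1 / ((k : ℝ) + 1) ^ 2)) atTop (𝓝 0) := by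
    rw [← ENNReal.ofReal_zero]
    refine ENNReal.tendsto_ofReal ?_
    generalize ∑' k : ℕ, 1 / ((k : ℝ) + 1) ^ 2 = c
    simpa using ((tendsto_one_div_atTop_nhds_zero_nat (𝕜 := ℝ)).const_mul
      (2 * Real.exp 2)).mul_const c
  refine tendsto_of_tendsto_of_tendsto_of_le_of_le' tendsto_const_nhds hup
    (Eventually.of_forall fun N => zero_le) ?_
  filter_upwards [eventually_gt_atTop 0] with N hN
  rw [Set.ofPred_exists]
  refine (measure_iUnion_le _).trans ((ENNReal.tsum_le_tsum fun k =>
    measure_mpeEps_lt_le h𝒢 hvc hmeas hN k).trans_eq ?_)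
  rw [← ENNReal.ofReal_tsum_of_nonneg (fun k => by positivity) (hs.mul_left _), tsum_mul_left]

theorem tendsto_measure_empMass_deviation {f : X → Fin 2} (hf : Measurable f) (Q : Measure X)
    [IsProbabilityMeasure Q] {ε : ℝ} (hε : 0 < ε) :
    Tendsto (fun N : ℕ => (Measure.pi fun _ : Fin N => Q)
      {z | ε ≤ |empMass f z - Q.real {x | f x = 1}|}) atTop (𝓝 0) := by
  have hup : Tendsto (fun N : ℕ => ENNReal.ofReal (1 / (4 * N * ε ^ 2))) atTop (𝓝 0) := by
    rw [← ENNReal.ofReal_zero]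
    refine ENNReal.tendsto_ofReal ?_
    have h := (tendsto_one_div_atTop_nhds_zero_nat (𝕜 := ℝ)).mul_const (1 / (4 * ε ^ 2))
    rw [zero_mul] at h
    refine h.congr fun N => ?_
    rw [one_div_mul_one_div]; congr 1; ring
  refine tendsto_of_tendsto_of_tendsto_of_le_of_le' tendsto_const_nhds hup
    (Eventually.of_forall fun N => zero_le) ?_
  filter_upwards [eventually_gt_atTop 0] with N hN
  exact measure_empMass_deviation_le hf Q hN hε

/-! ### Uniform deviations as min(m, n) → ∞ -/

theorem tendsto_min_minAtTop : Tendsto (fun p : ℕ × ℕ => min p.1 p.2) minAtTop atTop :=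
  tendsto_comap

theorem tendsto_fst_minAtTop : Tendsto (fun p : ℕ × ℕ => p.1) minAtTop atTop :=
  tendsto_atTop_mono (fun _ => min_le_left _ _) tendsto_min_minAtTop

theorem tendsto_snd_minAtTop : Tendsto (fun p : ℕ × ℕ => p.2) minAtTop atTop :=
  tendsto_atTop_mono (fun _ => min_le_right _ _) tendsto_min_minAtTop

theorem tendsto_swap_minAtTop : Tendsto Prod.swap minAtTop minAtTop := by
  refine tendsto_comap_iff.2 (tendsto_min_minAtTop.congr fun p => ?_)
  exact min_comm _ _

/-- log x / x decreases from e on, whence `3 ≤ l`. This carries the growth condition from the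
smaller sample size to the larger one. -/
theorem log_div_self_le {l m : ℕ} (hl : 3 ≤ l) (hlm : l ≤ m) :
    Real.log m / m ≤ Real.log l / l := by
  have h3 : (3 : ℝ) ≤ l := by exact_mod_cast hl
  have hm : (l : ℝ) ≤ m := by exact_mod_cast hlm
  have he := Real.exp_one_lt_d9
  exact Real.log_div_self_antitoneOn (Set.mem_Ici.2 (by linarith)) (Set.mem_Ici.2 (by linarith)) hm

theorem tendsto_measure_uniform_deviation {ℱ : ℕ → Set (X → Fin 2)}
    (hℱ : ∀ j, ∀ f ∈ ℱ j, Measurable f) {V : ℕ → ℕ} (hV : ∀ j, vcDimension (ℱ j) ≤ V j)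
    {Q : Measure X} [IsProbabilityMeasure Q] (hmeas : ∀ j, IsMeasurableClass (ℱ j) Q)
    {K M : ℕ × ℕ → ℕ} (hM : ∀ p, min p.1 p.2 ≤ M p)
    (hK : Tendsto (fun p : ℕ × ℕ => (V (K p) : ℝ) * Real.log ((min p.1 p.2 : ℕ) : ℝ) /
      ((min p.1 p.2 : ℕ) : ℝ)) minAtTop (𝓝 0)) {ε : ℝ} (hε : 0 < ε) :
    Tendsto (fun p => (Measure.pi fun _ : Fin (M p) => Q)
      {z | ∃ f ∈ ℱ (K p), ε < |empMass f z - Q.real {x | f x = 1}|}) minAtTop (𝓝 0) := by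
  have hlim : Tendsto (fun p : ℕ × ℕ => ((min p.1 p.2 : ℕ) : ℝ)) minAtTop atTop :=
    tendsto_natCast_atTop_atTop.comp tendsto_min_minAtTop
  have hup : Tendsto (fun p : ℕ × ℕ => ENNReal.ofReal
      (4 * Real.exp 2 * Real.exp (-(((min p.1 p.2 : ℕ) : ℝ) * (ε ^ 2 / 16))))) minAtTop (𝓝 0) := by
    rw [← ENNReal.ofReal_zero]
    refine ENNReal.tendsto_ofReal ?_
    have h := (Real.tendsto_exp_neg_atTop_nhds_zero.comp
      (hlim.atTop_mul_const (show 0 < ε ^ 2 / 16 by positivity))).const_mul (4 * Real.exp 2)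
    simpa using h
  refine tendsto_of_tendsto_of_tendsto_of_le_of_le' tendsto_const_nhds hup
    (Eventually.of_forall fun N => zero_le) ?_
  -- The thresholds serve monotonicity of log x / x, symmetrization, and the exponent: V log M takes
  -- at most half of M ε² / 8, leaving -M ε² / 16.
  filter_upwards [tendsto_min_minAtTop.eventually_ge_atTop 3,
    hlim.eventually_ge_atTop (2 / ε ^ 2),
    hK.eventually_lt_const (show 0 < ε ^ 2 / 16 by positivity)] with p hp3 hp2 hpK
  set l := min p.1 p.2 with hl
  have hlM : (l : ℝ) ≤ M p := by exact_mod_cast hM p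
  have hM3 : 3 ≤ M p := hp3.trans (hM p)
  have hM0 : (0 : ℝ) < M p := by positivity
  refine (measure_uniform_deviation_le (hℱ _) (hV _) (hmeas _) (by omega) hε ?_).trans
    (ENNReal.ofReal_le_ofReal ?_)
  · rw [div_le_iff₀ (by positivity)] at hp2
    exact hp2.trans (by gcongr)
  rw [mul_assoc (4 * Real.exp 2)]
  refine mul_le_mul_of_nonneg_left ?_ (by positivity)
  rw [← Real.exp_log hM0, ← Real.exp_nat_mul, Real.exp_log hM0, ← Real.exp_add, Real.exp_le_exp]
  have h1 : V (K p) * Real.log (M p) ≤ M p * (ε ^ 2 / 16) := by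
    have h2 : V (K p) * (Real.log (M p) / M p) ≤ ε ^ 2 / 16 := by
      refine le_trans ?_ hpK.le
      rw [mul_div_assoc]
      exact mul_le_mul_of_nonneg_left (log_div_self_le hp3 (hM p)) (Nat.cast_nonneg _)
    rw [← mul_div_assoc, div_le_iff₀ hM0] at h2
    linarith
  have h3 : (l : ℝ) * (ε ^ 2 / 16) ≤ M p * (ε ^ 2 / 16) := by gcongr
  linarith

/-! ### Stability of the plug-in formula and consistency of the proportion estimator -/

/-- The solution for the uncontaminated error, in terms of the masses `a`, `b` of `{f = 1}` under
the two contaminated distributions and the mixture proportion `p`. -/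
noncomputable def decontaminate (a b p : ℝ) : ℝ := b - (b - a) / (1 - p)

theorem exists_decontaminate_close {p ε : ℝ} (hp : p < 1) (hε : 0 < ε) :
    ∃ η > 0, ∀ a b A B p' : ℝ, 0 ≤ A → A ≤ 1 → 0 ≤ B → B ≤ 1 → |a - A| ≤ η → |b - B| ≤ η →
      |p' - p| ≤ η → |decontaminate a b p' - decontaminate A B p| ≤ ε := by
  set q := 1 - p with hq
  have hq0 : 0 < q := by linarith
  -- The total Lipschitz constant once η ≤ q / 2 has forced 1 - p' ≥ q / 2.
  set c := 1 + 4 / q + 2 / q ^ 2 with hc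
  have hc0 : 0 < c := by positivity
  refine ⟨min (q / 2) (ε / c), by positivity, fun a b A B p' hA0 hA1 hB0 hB1 ha hb hpp => ?_⟩
  set η := min (q / 2) (ε / c)
  have hηq : η ≤ q / 2 := min_le_left _ _
  have hηc : η * c ≤ ε := (le_div_iff₀ hc0).1 (min_le_right _ _)
  set q' := 1 - p' with hq'
  have hqq : |q - q'| ≤ η := by
    rw [hq, hq', show 1 - p - (1 - p') = p' - p by ring]; exact hpp
  have hq'2 : q / 2 ≤ q' := by linarith [(abs_le.1 hqq).2]
  have hq'0 : 0 < q' := by linarith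
  have key : decontaminate a b p' - decontaminate A B p =
      (b - B) - (((b - B) - (a - A)) / q' + (B - A) * (q - q') / (q * q')) := by
    simp only [decontaminate, ← hq, ← hq']
    field_simp
    ring
  have h0 : 0 ≤ η := (abs_nonneg _).trans ha
  have h1 : |((b - B) - (a - A)) / q'| ≤ 2 * η / (q / 2) := by
    rw [abs_div, abs_of_pos hq'0]
    have := abs_sub (b - B) (a - A)
    gcongr
    linarith
  have h2 : |(B - A) * (q - q') / (q * q')| ≤ 1 * η / (q * (q / 2)) := by
    rw [abs_div, abs_mul, abs_of_pos (mul_pos hq0 hq'0)]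
    have : |B - A| ≤ 1 := abs_le.2 ⟨by linarith, by linarith⟩
    gcongr
  have h3 := abs_add_le (((b - B) - (a - A)) / q') ((B - A) * (q - q') / (q * q'))
  have h4 := abs_sub (b - B) (((b - B) - (a - A)) / q' + (B - A) * (q - q') / (q * q'))
  rw [key]
  have h5 : η + (2 * η / (q / 2) + 1 * η / (q * (q / 2))) = η * c := by
    rw [hc]; field_simp; ring
  linarith

theorem decontaminate_mix {π₀ π₁ : ℝ} (hπ₀ : 0 ≤ π₀) (hπ₁ : 0 ≤ π₁) (hA : π₀ + π₁ < 1)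
    (P₀ P₁ : Measure X) [IsProbabilityMeasure P₀] [IsProbabilityMeasure P₁] (s : Set X) :
    decontaminate ((mix π₀ P₀ P₁).real s) ((mix π₁ P₁ P₀).real s) (π₀ / (1 - π₁)) = P₀.real s := by
  rw [mix_real_apply hπ₀ (by linarith), mix_real_apply hπ₁ (by linarith), decontaminate]
  have h1 : 1 - π₁ ≠ 0 := by linarith
  have h2 : 1 - π₁ - π₀ ≠ 0 := by linarith
  rw [show 1 - π₀ / (1 - π₁) = (1 - π₁ - π₀) / (1 - π₁) by field_simp]
  field_simp
  ring

/-- On the event that all deviation bounds hold, the estimator is close to the true proportion as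
soon as the samples are large. -/
theorem exists_mpe_close {𝒢 : ℕ → Set (X → Fin 2)} (F H : Measure X) {p η : ℝ}
    (hp : 0 ≤ p) (hη : 0 < η)
    (hdom : ∀ C : Set X, p * H.real C ≤ F.real C) {k₀ : ℕ} {g₀ : X → Fin 2} (hg₀ : g₀ ∈ 𝒢 k₀)
    (hlt : F.real {x | g₀ x = 1} < (p + η) * H.real {x | g₀ x = 1}) :
    ∃ τ > 0, ∃ N₀ : ℕ, ∀ m n, N₀ ≤ m → N₀ ≤ n → ∀ (zF : Fin m → X) (zH : Fin n → X),
      (∀ k, ∀ g ∈ 𝒢 k, |empMass g zF - F.real {x | g x = 1}| ≤ mpeEps 𝒢 k m) →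
      (∀ k, ∀ g ∈ 𝒢 k, |empMass g zH - H.real {x | g x = 1}| ≤ mpeEps 𝒢 k n) →
      |empMass g₀ zF - F.real {x | g₀ x = 1}| < τ →
      |empMass g₀ zH - H.real {x | g₀ x = 1}| < τ → |mpe 𝒢 zF zH - p| ≤ η := by
  set a := F.real {x | g₀ x = 1}
  set b := H.real {x | g₀ x = 1}
  have ha : 0 ≤ a := measureReal_nonneg
  have hb : 0 < b := pos_of_mul_pos_right (ha.trans_lt hlt) (by positivity)
  set d := (p + η) * b - a with hd
  have hd0 : 0 < d := by linarith
  -- The first bound keeps the corrected denominator at least b - 2τ > 0; the second is equivalent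
  -- to a + 2τ ≤ (p + η) (b - 2τ).
  set τ := min (b / 4) (d / (2 * (1 + p + η))) with hτ
  have hτ0 : 0 < τ := by positivity
  have hτb : τ ≤ b / 4 := min_le_left _ _
  have hτd : τ * (2 * (1 + p + η)) ≤ d := (le_div_iff₀ (by positivity)).1 (min_le_right _ _)
  obtain ⟨N₀, hN₀⟩ := eventually_atTop.1 ((tendsto_mpeEps 𝒢 k₀).eventually_le_const hτ0)
  refine ⟨τ, hτ0, N₀, fun m n hm hn zF zH hF hH hgF hgH => ?_⟩
  have hm' := hN₀ m hm
  have hn' := hN₀ n hn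
  have hgF' := abs_lt.1 hgF
  have hgH' := abs_lt.1 hgH
  have hden : 0 < empMass g₀ zH - mpeEps 𝒢 k₀ n := by linarith
  have hlow : ∀ r ∈ {r : ℝ | ∃ k : ℕ, ∃ g ∈ 𝒢 k, 0 < empMass g zH - mpeEps 𝒢 k n ∧
      r = (empMass g zF + mpeEps 𝒢 k m) / (empMass g zH - mpeEps 𝒢 k n)}, p ≤ r := by
    rintro r ⟨k, g, hg, hpos, rfl⟩
    rw [le_div_iff₀ hpos]
    have h1 := (abs_le.1 (hF k g hg)).1
    have h2 := (abs_le.1 (hH k g hg)).2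
    calc p * (empMass g zH - mpeEps 𝒢 k n) ≤ p * H.real {x | g x = 1} :=
          mul_le_mul_of_nonneg_left (by linarith) hp
      _ ≤ F.real {x | g x = 1} := hdom _
      _ ≤ _ := by linarith
  -- Besides the upper bound, this excludes the default value 0 of an empty infimum.
  have hmem : (empMass g₀ zF + mpeEps 𝒢 k₀ m) / (empMass g₀ zH - mpeEps 𝒢 k₀ n) ∈
      {r : ℝ | ∃ k : ℕ, ∃ g ∈ 𝒢 k, 0 < empMass g zH - mpeEps 𝒢 k n ∧
      r = (empMass g zF + mpeEps 𝒢 k m) / (empMass g zH - mpeEps 𝒢 k n)} :=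
    ⟨k₀, g₀, hg₀, hden, rfl⟩
  have hge : p ≤ mpe 𝒢 zF zH := le_csInf ⟨_, hmem⟩ hlow
  have hle : mpe 𝒢 zF zH ≤ p + η := by
    refine (csInf_le ⟨p, hlow⟩ hmem).trans ?_
    rw [div_le_iff₀ hden]
    calc empMass g₀ zF + mpeEps 𝒢 k₀ m ≤ a + 2 * τ := by linarith
      _ ≤ (p + η) * (b - 2 * τ) := by linarith
      _ ≤ _ := mul_le_mul_of_nonneg_left (by linarith) (by positivity)
  exact abs_le.2 ⟨by linarith, by linarith⟩

/-! ### Bad events under the joint law of the samples -/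

/-- The product formula for rectangles holds for arbitrary sets, so outer probabilities are handled
without measurability of `A`. -/
theorem sampleLaw_fst_le (Q₀ Q₁ : Measure X) [IsProbabilityMeasure Q₀] [IsProbabilityMeasure Q₁]
    {m n : ℕ} (A : Set (Fin m → X)) :
    sampleLaw Q₀ Q₁ m n {z | z.1 ∈ A} ≤ (Measure.pi fun _ : Fin m => Q₀) A := by
  rw [sampleLaw, show {z : (Fin m → X) × (Fin n → X) | z.1 ∈ A} = A ×ˢ Set.univ by ext; simp,
    Measure.prod_prod, measure_univ, mul_one]

theorem sampleLaw_snd_le (Q₀ Q₁ : Measure X) [IsProbabilityMeasure Q₀] [IsProbabilityMeasure Q₁]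
    {m n : ℕ} (A : Set (Fin n → X)) :
    sampleLaw Q₀ Q₁ m n {z | z.2 ∈ A} ≤ (Measure.pi fun _ : Fin n => Q₁) A := by
  rw [sampleLaw, show {z : (Fin m → X) × (Fin n → X) | z.2 ∈ A} = Set.univ ×ˢ A by ext; simp,
    Measure.prod_prod, measure_univ, one_mul]

theorem sampleLaw_swap (Q₀ Q₁ : Measure X) [IsProbabilityMeasure Q₀] [IsProbabilityMeasure Q₁]
    (m n : ℕ) (A : Set ((Fin n → X) × (Fin m → X))) :
    sampleLaw Q₀ Q₁ m n {z | z.swap ∈ A} = sampleLaw Q₁ Q₀ n m A := by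
  unfold sampleLaw
  rw [← Measure.prod_swap (μ := Measure.pi fun _ : Fin m => Q₀)]
  exact (MeasurableEquiv.prodComm.map_apply A).symm

/-- Uniform consistency of the decontaminated mass of `{f = 1}`. -/
theorem tendsto_measure_decontaminate {π₀ π₁ : ℝ} (hπ₀ : 0 ≤ π₀) (hπ₁ : 0 ≤ π₁)
    (hA : π₀ + π₁ < 1) (P₀ P₁ : Measure X) [IsProbabilityMeasure P₀] [IsProbabilityMeasure P₁]
    (hC : IrreducibleWrt P₀ P₁) {Pt₀ Pt₁ : Measure X} (hPt₀ : Pt₀ = mix π₀ P₀ P₁)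
    (hPt₁ : Pt₁ = mix π₁ P₁ P₀) {𝒢 : ℕ → Set (X → Fin 2)}
    (h𝒢 : ∀ j, ∀ g ∈ 𝒢 j, Measurable g) (h𝒢vc : ∀ j, vcDimension (𝒢 j) ≠ ⊤)
    (h𝒢approx : UniversalApprox 𝒢)
    (h𝒢meas : ∀ j, IsMeasurableClass (𝒢 j) Pt₀ ∧ IsMeasurableClass (𝒢 j) Pt₁)
    {ℱ : ℕ → Set (X → Fin 2)} (hℱ : ∀ j, ∀ f ∈ ℱ j, Measurable f)
    {V : ℕ → ℕ} (hV : ∀ j, vcDimension (ℱ j) = (V j : ℕ∞))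
    (hℱmeas : ∀ j, IsMeasurableClass (ℱ j) Pt₀ ∧ IsMeasurableClass (ℱ j) Pt₁)
    {K : ℕ × ℕ → ℕ}
    (hK : Tendsto (fun p : ℕ × ℕ => (V (K p) : ℝ) * Real.log ((min p.1 p.2 : ℕ) : ℝ) /
      ((min p.1 p.2 : ℕ) : ℝ)) minAtTop (𝓝 0)) {ε : ℝ} (hε : 0 < ε) :
    Tendsto (fun p : ℕ × ℕ => sampleLaw Pt₀ Pt₁ p.1 p.2
      {z | ∃ f ∈ ℱ (K p), ε < |decontaminate (empMass f z.1) (empMass f z.2) (mpe 𝒢 z.1 z.2)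
        - P₀.real {x | f x = 1}|}) minAtTop (𝓝 0) := by
  have : IsProbabilityMeasure Pt₀ := hPt₀ ▸ isProbabilityMeasure_mix hπ₀ (by linarith) _ _
  have : IsProbabilityMeasure Pt₁ := hPt₁ ▸ isProbabilityMeasure_mix hπ₁ (by linarith) _ _
  have hp0 : 0 ≤ π₀ / (1 - π₁) := div_nonneg hπ₀ (by linarith)
  have hp1 : π₀ / (1 - π₁) < 1 := (div_lt_one (by linarith)).2 (by linarith)
  obtain ⟨η, hη, hclose⟩ := exists_decontaminate_close hp1 hε
  obtain ⟨k₀, g₀, hg₀, hlt⟩ := exists_classifier_ratio_lt hπ₀ hπ₁ hA P₀ P₁ hC h𝒢approx hη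
  have hdom : ∀ C : Set X, π₀ / (1 - π₁) * Pt₁.real C ≤ Pt₀.real C := fun C => by
    rw [hPt₀, hPt₁]; exact proportion_mul_le hπ₀ hπ₁ hA P₀ P₁ C
  rw [← hPt₀, ← hPt₁] at hlt
  obtain ⟨τ, hτ, N₀, hmpe⟩ := exists_mpe_close Pt₀ Pt₁ hp0 hη hdom hg₀ hlt
  have hD0 := tendsto_measure_uniform_deviation hℱ (fun j => (hV j).le) (fun j => (hℱmeas j).1)
    (M := Prod.fst) (fun _ => min_le_left _ _) hK hη
  have hD1 := tendsto_measure_uniform_deviation hℱ (fun j => (hV j).le) (fun j => (hℱmeas j).2)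
    (M := Prod.snd) (fun _ => min_le_right _ _) hK hη
  have hU0 := (tendsto_measure_mpeEps_lt h𝒢 h𝒢vc fun j => (h𝒢meas j).1).comp tendsto_fst_minAtTop
  have hU1 := (tendsto_measure_mpeEps_lt h𝒢 h𝒢vc fun j => (h𝒢meas j).2).comp tendsto_snd_minAtTop
  have hL0 := (tendsto_measure_empMass_deviation (h𝒢 k₀ g₀ hg₀) Pt₀ hτ).comp tendsto_fst_minAtTop
  have hL1 := (tendsto_measure_empMass_deviation (h𝒢 k₀ g₀ hg₀) Pt₁ hτ).comp tendsto_snd_minAtTop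
  have hup := ((hD0.add hU0).add hL0).add ((hD1.add hU1).add hL1)
  simp only [add_zero, Function.comp_def] at hup
  refine tendsto_of_tendsto_of_tendsto_of_le_of_le' tendsto_const_nhds hup
    (Eventually.of_forall fun N => zero_le) ?_
  filter_upwards [tendsto_fst_minAtTop.eventually_ge_atTop N₀,
    tendsto_snd_minAtTop.eventually_ge_atTop N₀] with p hpm hpn
  set A₀ := {z : Fin p.1 → X | ∃ f ∈ ℱ (K p), η < |empMass f z - Pt₀.real {x | f x = 1}|}
  set B₀ := {z : Fin p.1 → X | ∃ k, ∃ g ∈ 𝒢 k,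
    mpeEps 𝒢 k p.1 < |empMass g z - Pt₀.real {x | g x = 1}|}
  set C₀ := {z : Fin p.1 → X | τ ≤ |empMass g₀ z - Pt₀.real {x | g₀ x = 1}|}
  set A₁ := {z : Fin p.2 → X | ∃ f ∈ ℱ (K p), η < |empMass f z - Pt₁.real {x | f x = 1}|}
  set B₁ := {z : Fin p.2 → X | ∃ k, ∃ g ∈ 𝒢 k,
    mpeEps 𝒢 k p.2 < |empMass g z - Pt₁.real {x | g x = 1}|}
  set C₁ := {z : Fin p.2 → X | τ ≤ |empMass g₀ z - Pt₁.real {x | g₀ x = 1}|}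
  have hsub : {z : (Fin p.1 → X) × (Fin p.2 → X) | ∃ f ∈ ℱ (K p), ε <
      |decontaminate (empMass f z.1) (empMass f z.2) (mpe 𝒢 z.1 z.2) - P₀.real {x | f x = 1}|} ⊆
      {z | z.1 ∈ A₀ ∪ B₀ ∪ C₀} ∪ {z | z.2 ∈ A₁ ∪ B₁ ∪ C₁} := by
    rintro z ⟨f, hf, hz⟩
    by_contra hcon
    simp only [Set.mem_union, Set.mem_ofPred_eq, not_or] at hcon
    obtain ⟨⟨⟨hA0, hB0⟩, hC0⟩, ⟨hA1, hB1⟩, hC1⟩ := hcon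
    have hm := hmpe _ _ hpm hpn z.1 z.2 (fun k g hg => not_lt.1 fun h => hB0 ⟨k, g, hg, h⟩)
      (fun k g hg => not_lt.1 fun h => hB1 ⟨k, g, hg, h⟩) (not_le.1 hC0) (not_le.1 hC1)
    have hfin := hclose (empMass f z.1) (empMass f z.2) (Pt₀.real {x | f x = 1})
      (Pt₁.real {x | f x = 1}) _ measureReal_nonneg measureReal_le_one measureReal_nonneg
      measureReal_le_one (not_lt.1 fun h => hA0 ⟨f, hf, h⟩) (not_lt.1 fun h => hA1 ⟨f, hf, h⟩) hm
    have hdec := decontaminate_mix hπ₀ hπ₁ hA P₀ P₁ {x | f x = 1}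
    rw [← hPt₀, ← hPt₁] at hdec
    rw [hdec] at hfin
    exact absurd hz (not_lt.2 hfin)
  refine (measure_mono hsub).trans ((measure_union_le _ _).trans (add_le_add ?_ ?_))
  · refine (sampleLaw_fst_le _ _ _).trans ((measure_union_le _ _).trans ?_)
    gcongr
    exact measure_union_le _ _
  · refine (sampleLaw_snd_le _ _ _).trans ((measure_union_le _ _).trans ?_)
    gcongr
    exact measure_union_le _ _

/-! ### The estimators in terms of empirical masses -/

theorem empError_zero {X : Type*} {N : ℕ} (f : X → Fin 2) (z : Fin N → X) :
    empError 0 f z = empMass f z := by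
  unfold empError empMass
  congr 2 with i
  generalize f (z i) = a
  fin_cases a <;> simp

/-- An empty sample must be excluded: its error and its mass are both 0. -/
theorem empError_one {X : Type*} {N : ℕ} (hN : 0 < N) (f : X → Fin 2) (z : Fin N → X) :
    empError 1 f z = 1 - empMass f z := by
  have hN' : (N : ℝ) ≠ 0 := by positivity
  rw [eq_sub_iff_add_eq, empError, empMass, ← mul_add, ← Finset.sum_add_distrib]
  have : ∀ i, (if f (z i) ≠ 1 then (1 : ℝ) else 0) + (if f (z i) = 1 then 1 else 0) = 1 := by
    intro i; by_cases h : f (z i) = 1 <;> simp [h]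
  rw [Finset.sum_congr rfl fun i _ => this i]
  simp [hN']

theorem estTypeI_eq {X : Type*} (𝒢 : ℕ → Set (X → Fin 2)) {m n : ℕ} (hn : 0 < n)
    (f : X → Fin 2) (z₀ : Fin m → X) (z₁ : Fin n → X) :
    estTypeI 𝒢 f z₀ z₁ = decontaminate (empMass f z₀) (empMass f z₁) (mpe 𝒢 z₀ z₁) := by
  rw [estTypeI, decontaminate, empError_zero, empError_one hn]
  ring

/-- With the samples exchanged, `decontaminate` estimates P₁(f = 1), the complement of the Type II
error. -/
theorem estTypeII_eq {X : Type*} (𝒢 : ℕ → Set (X → Fin 2)) {m n : ℕ} (hn : 0 < n)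
    (f : X → Fin 2) (z₀ : Fin m → X) (z₁ : Fin n → X) :
    estTypeII 𝒢 f z₀ z₁ = 1 - decontaminate (empMass f z₁) (empMass f z₀) (mpe 𝒢 z₁ z₀) := by
  rw [estTypeII, decontaminate, empError_zero, empError_one hn]
  ring

theorem typeII_eq (P : Measure X) [IsProbabilityMeasure P] {f : X → Fin 2} (hf : Measurable f) :
    typeII P f = 1 - P.real {x | f x = 1} := by
  have hs : MeasurableSet {x | f x = 1} := hf (measurableSet_singleton 1)
  rw [← probReal_compl_eq_one_sub hs, typeII]
  congr 1
  ext x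
  simp only [Set.mem_ofPred_eq, Set.mem_compl_iff]
  generalize f x = a
  fin_cases a <;> simp

/-- The empty supremum is 0, which is why ε must be nonnegative. -/
theorem exists_lt_of_lt_iSup {α : Type*} {s : Set α} {u : α → ℝ} {ε : ℝ} (hε : 0 ≤ ε)
    (h : ε < ⨆ f : s, u f) : ∃ f ∈ s, ε < u f := by
  by_contra! hcon
  exact absurd (Real.iSup_le (fun f : s => hcon f f.2) hε) (not_le.2 h)

end LabelNoise

/-! ### The main theorem -/

theorem mainTheorem2 {X : Type*} [MeasurableSpace X]
    (P₀ P₁ : Measure X) [IsProbabilityMeasure P₀] [IsProbabilityMeasure P₁]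
    (π₀ π₁ : ℝ) (hπ₀ : 0 ≤ π₀) (hπ₁ : 0 ≤ π₁)
    -- total noise level
    (hA : π₀ + π₁ < 1)
    -- mutual irreducibility
    (hC : MutuallyIrreducible P₀ P₁)
    -- the contaminated distributions
    (Pt₀ Pt₁ : Measure X) (hPt₀ : Pt₀ = mix π₀ P₀ P₁) (hPt₁ : Pt₁ = mix π₁ P₁ P₀)
    -- the classes on which the mixture proportion estimator is built
    (𝒢 : ℕ → Set (X → Fin 2))
    (h𝒢 : ∀ j, ∀ g ∈ 𝒢 j, Measurable g)
    (h𝒢vc : ∀ j, vcDimension (𝒢 j) ≠ ⊤)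
    (h𝒢approx : UniversalApprox 𝒢)
    (h𝒢meas : ∀ j, IsMeasurableClass (𝒢 j) Pt₀ ∧ IsMeasurableClass (𝒢 j) Pt₁)
    -- the sets of classifiers
    (ℱ : ℕ → Set (X → Fin 2))
    (hℱ : ∀ j, ∀ f ∈ ℱ j, Measurable f)
    (V : ℕ → ℕ) (hV : ∀ j, vcDimension (ℱ j) = (V j : ℕ∞))
    (hℱmeas : ∀ j, IsMeasurableClass (ℱ j) Pt₀ ∧ IsMeasurableClass (ℱ j) Pt₁)
    (k : ℕ → ℕ → ℕ)
    (hk : Tendsto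
      (fun p : ℕ × ℕ =>
        (V (k p.1 p.2) : ℝ) * Real.log ((min p.1 p.2 : ℕ) : ℝ) / ((min p.1 p.2 : ℕ) : ℝ))
      minAtTop (𝓝 0)) :
    (∀ ε : ℝ, 0 < ε →
      Tendsto
        (fun p : ℕ × ℕ => sampleLaw Pt₀ Pt₁ p.1 p.2
          {z | ε < ⨆ f : ℱ (k p.1 p.2), |estTypeI 𝒢 (f : X → Fin 2) z.1 z.2 - typeI P₀ f|})
        minAtTop (𝓝 0)) ∧
    (∀ ε : ℝ, 0 < ε →
      Tendsto
        (fun p : ℕ × ℕ => sampleLaw Pt₀ Pt₁ p.1 p.2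
          {z | ε < ⨆ f : ℱ (k p.1 p.2), |estTypeII 𝒢 (f : X → Fin 2) z.1 z.2 - typeII P₁ f|})
        minAtTop (𝓝 0)) := by

  have hPt₀p : IsProbabilityMeasure Pt₀ := hPt₀ ▸ isProbabilityMeasure_mix hπ₀ (by linarith) _ _
  have hPt₁p : IsProbabilityMeasure Pt₁ := hPt₁ ▸ isProbabilityMeasure_mix hπ₁ (by linarith) _ _
  constructor
  · intro ε hε
    refine tendsto_of_tendsto_of_tendsto_of_le_of_le' tendsto_const_nhds
      (tendsto_measure_decontaminate hπ₀ hπ₁ hA P₀ P₁ hC.1 hPt₀ hPt₁ h𝒢 h𝒢vc h𝒢approx h𝒢meas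
        hℱ hV hℱmeas (K := fun p => k p.1 p.2) hk hε)
      (Eventually.of_forall fun N => zero_le) ?_
    filter_upwards [tendsto_snd_minAtTop.eventually_gt_atTop 0] with p hp
    refine measure_mono fun z hz => ?_
    obtain ⟨f, hf, hlt⟩ := exists_lt_of_lt_iSup
      (u := fun f => |estTypeI 𝒢 f z.1 z.2 - typeI P₀ f|) hε.le hz
    refine ⟨f, hf, ?_⟩
    rwa [estTypeI_eq 𝒢 hp, typeI] at hlt
  · intro ε hε
    -- Type II is the Type I statement with the two distributions exchanged, so the class index is
    -- read at the transposed pair; the minimum is symmetric.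
    have hk' : Tendsto (fun p : ℕ × ℕ => (V (k p.2 p.1) : ℝ) *
        Real.log ((min p.1 p.2 : ℕ) : ℝ) / ((min p.1 p.2 : ℕ) : ℝ)) minAtTop (𝓝 0) := by
      refine (hk.comp tendsto_swap_minAtTop).congr fun p => ?_
      simp only [Function.comp_apply, Prod.fst_swap, Prod.snd_swap, min_comm p.2]
    refine tendsto_of_tendsto_of_tendsto_of_le_of_le' tendsto_const_nhds
      ((tendsto_measure_decontaminate hπ₁ hπ₀ (by linarith) P₁ P₀ hC.2 hPt₁ hPt₀ h𝒢 h𝒢vc h𝒢approx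
        (fun j => (h𝒢meas j).symm) hℱ hV (fun j => (hℱmeas j).symm)
        (K := fun p => k p.2 p.1) hk' hε).comp tendsto_swap_minAtTop)
      (Eventually.of_forall fun N => zero_le) ?_
    filter_upwards [tendsto_snd_minAtTop.eventually_gt_atTop 0] with p hp
    simp only [Function.comp_apply, Prod.fst_swap, Prod.snd_swap]
    rw [← sampleLaw_swap]
    refine measure_mono fun z hz => ?_
    obtain ⟨f, hf, hlt⟩ := exists_lt_of_lt_iSup
      (u := fun f => |estTypeII 𝒢 f z.2 z.1 - typeII P₁ f|) hε.le hz
    refine ⟨f, hf, ?_⟩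
    rw [estTypeII_eq 𝒢 hp, typeII_eq P₁ (hℱ _ f hf), sub_sub_sub_cancel_left, abs_sub_comm] at hlt
    exact hlt
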